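/- Equip $\mathbb C^d\times\mathbb R$, with coordinates $(x_1,y_1,\dots,x_d,y_d,z)$, with the contact form $dz-\sum_j y_j\,dx_j$. *Loose.* Let $n\ge 1$. For $a,b,c>0$ let $$R^{n-1}_{abc}=\{|x|,|y|\le 1,\ \|(x_1,\dots,x_{n-1})\|\le b,\ \|(y_1,\dots,y_{n-1})\|\le c,\ |z|\le a\}\subset\mathbb C^n\times\mathbb R,$$ where the coordinates on $\mathbb C^n\times\mathbb R$ are here written $(x,y,x_1,y_1,\dots,x_{n-1},y_{n-1},z)$. A *model arc* $\lambda_0$ of height $a$ is an embedded compact Legendrian arc in $(\mathbb R^3,dz-y\,dx)$ which is contained in $Q_a=\{|x|\le1,|y|\le1,|z|\le a\}$, has $\partial\lambda_0\subset\partial Q_a$, and whose front (its projection to the $(x,z)$-plane) has exactly one cusp, which is semicubical, and exactly one self-intersection, at which the two slopes $dz/dx$ are $1$ and $-1$. Put $$\Lambda_0=\lambda_0\times\{\|(x_1,\dots,x_{n-1})\|\le b,\ y_1=\dots=y_{n-1}=0\}\subset R^{n-1}_{abc}.$$ A Legendrian submanifold $\Lambda\subset\mathbb C^n\times\mathbb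 R$ is *loose* if there are $a,b,c>0$ with $a<bc$, a model arc $\lambda_0$ of height $a$, and a subset $U\subset\mathbb C^n\times\mathbb R$ such that $(U,U\cap\Lambda)$ is contactomorphic to $(R^{n-1}_{abc},\Lambda_0)$. *Front spinning.* Let $m\ge0$, let $S^m\subset\mathbb R^{m+1}$ be the unit sphere, let $M$ be a closed $n$-manifold, and let $f=(x_1,y_1,\dots,x_n,y_n,z):M\to\mathbb C^n\times\mathbb R$ be a Legendrian embedding with image $\Lambda$. If $x_n>0$ on $\Lambda$, the front $S^m$-spinning $\Sigma_{S^m}\Lambda\subset\mathbb C^{n+m}\times\mathbb R$ is the image of the map $M\times S^m\to\mathbb C^{n+m}\times\mathbb R$ which sends $(p,\theta)$ to the point with $x$-coordinates $(x_1(p),\dots,x_{n-1}(p),x_n(p)\,\theta)$, $y$-coordinates $(y_1(p),\dots,y_{n-1}(p),y_n(p)\,\theta)$ and $z$-coordinate $z(p)$; this is the Legendrian lift of the front $(p,\theta)\mapsto(x_1(p),\dots,x_{n-1}(p),x_n(p)\theta,z(p))$. For general $\Lambda$, one first applies a translation $x_n\mapsto x_n+s$ after which $x_n>0$ on $\Lambda$.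 **Proposition.** Let $\Lambda=f(M)\subset\mathbb C^n\times\mathbb R$ be a closed Legendrian submanifold, with $n\ge1$ and $m\ge0$. If $\Lambda$ is loose, then there are translations $x_n\mapsto x_n+s$ after which $x_n>0$ on $\Lambda$, and for every such translation the map $M\times S^m\to\mathbb C^{n+m}\times\mathbb R$ above, formed from the translated embedding, is a Legendrian embedding whose image $\Sigma_{S^m}\Lambda$ is a loose Legendrian submanifold of $\mathbb C^{n+m}\times\mathbb R$. -/

import Mathlib

open Set Topology
open scoped Manifold ContDiff

/-- The underlying manifold of `ℂᵈ × ℝ = J¹(ℝᵈ)`.  A point is a triple `(x, y, z)` with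
`x = (x₀, …, x_{d-1})`, `y = (y₀, …, y_{d-1})` and `z ∈ ℝ`; the complex coordinates are
`x_j + i y_j`. -/
abbrev JetSpace (d : ℕ) : Type :=
  EuclideanSpace ℝ (Fin d) × EuclideanSpace ℝ (Fin d) × ℝ

/-- The standard contact form `dz - ∑ y_j dx_j`, at the point `w`, on the tangent vector `v`. -/
def contactForm {d : ℕ} (w v : JetSpace d) : ℝ :=
  v.2.2 - ∑ j, w.2.1 j * v.1 j

/-- `f : M → ℂᵈ × ℝ` is a (smooth) Legendrian embedding: an embedding of a `d`-dimensional
manifold that is everywhere tangent to the kernel of the contact form. -/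
structure IsLegendrianEmbedding {E H M : Type*} [NormedAddCommGroup E] [NormedSpace ℝ E]
    [TopologicalSpace H] (I : ModelWithCorners ℝ E H) [TopologicalSpace M] [ChartedSpace H M]
    {d : ℕ} (f : M → JetSpace d) : Prop where
  finrank_eq : Module.finrank ℝ E = d
  contMDiff : ContMDiff I 𝓘(ℝ, JetSpace d) ∞ f
  injective_mfderiv : ∀ p, Function.Injective (mfderiv I 𝓘(ℝ, JetSpace d) f p)
  isEmbedding : IsEmbedding f
  tangent : ∀ (p : M) (v : TangentSpace I p),
    contactForm (f p) (mfderiv I 𝓘(ℝ, JetSpace d) f p v : JetSpace d) = 0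

/-- `lam ⊂ ℝ³` (coordinates `(x, y, z)`, contact form `dz - y dx`) is a model arc for loose
charts of height `a`: an embedded compact Legendrian arc contained in the box
`Q_a = {|x| ≤ 1, |y| ≤ 1, |z| ≤ a}` with end points on the boundary of `Q_a`, whose front
`(x, z)` has exactly one cusp, which is semicubical, and exactly one self-intersection, at which
the two slopes `y = dz/dx` are `1` and `-1`.  (The slopes lie in `[-1, 1]` because `|y| ≤ 1`.) -/
def IsModelArc (a : ℝ) (lam : Set (ℝ × ℝ × ℝ)) : Prop :=
  ∃ x y z : ℝ → ℝ,
    ContDiff ℝ ∞ x ∧ ContDiff ℝ ∞ y ∧ ContDiff ℝ ∞ z ∧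
    lam = (fun t => (x t, y t, z t)) '' Icc (-1) 1 ∧
    -- embedded arc
    InjOn (fun t => (x t, y t, z t)) (Icc (-1) 1) ∧
    (∀ t ∈ Icc (-1 : ℝ) 1, deriv x t ≠ 0 ∨ deriv y t ≠ 0) ∧
    -- Legendrian
    (∀ t ∈ Icc (-1 : ℝ) 1, deriv z t = y t * deriv x t) ∧
    -- contained in the box, end points on its boundary
    (∀ t ∈ Icc (-1 : ℝ) 1, |x t| ≤ 1 ∧ |y t| ≤ 1 ∧ |z t| ≤ a) ∧
    (∀ t ∈ ({-1, 1} : Set ℝ), |x t| = 1 ∨ |y t| = 1 ∨ |z t| = a) ∧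
    -- exactly one cusp of the front
    (∃ t₀ ∈ Ioo (-1 : ℝ) 1, deriv (deriv x) t₀ ≠ 0 ∧
      ∀ t ∈ Icc (-1 : ℝ) 1, deriv x t = 0 ↔ t = t₀) ∧
    -- exactly one self-intersection of the front, with slopes `1` and `-1`
    (∃ t₁ ∈ Ioo (-1 : ℝ) 1, ∃ t₂ ∈ Ioo (-1 : ℝ) 1, t₁ < t₂ ∧
      (y t₁ = 1 ∧ y t₂ = -1 ∨ y t₁ = -1 ∧ y t₂ = 1) ∧
      ∀ s ∈ Icc (-1 : ℝ) 1, ∀ t ∈ Icc (-1 : ℝ) 1, s < t →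
        (x s = x t ∧ z s = z t ↔ s = t₁ ∧ t = t₂))

/-- The box `R^k_{abc} ⊂ ℂ^{k+1} × ℝ`.  The distinguished pair `(x, y)` consists of the
coordinates with index `0`; the remaining `k` pairs have the indices `i.succ`. -/
def looseBox (k : ℕ) (a b c : ℝ) : Set (JetSpace (k + 1)) :=
  {w | |w.1 0| ≤ 1 ∧ |w.2.1 0| ≤ 1 ∧
    √(∑ i : Fin k, w.1 i.succ ^ 2) ≤ b ∧ √(∑ i : Fin k, w.2.1 i.succ ^ 2) ≤ c ∧ |w.2.2| ≤ a}

/-- The solid cylinder `Λ₀ = lam × D^k_b ⊂ ℂ^{k+1} × ℝ`. -/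
def looseCylinder (k : ℕ) (b : ℝ) (lam : Set (ℝ × ℝ × ℝ)) : Set (JetSpace (k + 1)) :=
  {w | (w.1 0, w.2.1 0, w.2.2) ∈ lam ∧
    √(∑ i : Fin k, w.1 i.succ ^ 2) ≤ b ∧ ∀ i : Fin k, w.2.1 i.succ = 0}

/-- `ψ` is a contactomorphism from the pair `(R^k_{abc}, Λ₀)` onto the pair `(U, U ∩ L)`, where
`U = ψ '' R^k_{abc} ⊂ ℂ^{k+1} × ℝ`: on the box, `ψ` is smooth, injective, has invertible
derivative, pulls the contact form back to a nowhere vanishing multiple of the contact form, and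
the points that it maps into `L` are those of `Λ₀`. -/
structure IsLooseChart {k : ℕ} (a b c : ℝ) (lam : Set (ℝ × ℝ × ℝ)) (L : Set (JetSpace (k + 1)))
    (ψ : JetSpace (k + 1) → JetSpace (k + 1)) : Prop where
  contDiffOn : ContDiffOn ℝ ∞ ψ (looseBox k a b c)
  injOn : InjOn ψ (looseBox k a b c)
  bijective_fderivWithin : ∀ w ∈ looseBox k a b c,
    Function.Bijective (fderivWithin ℝ ψ (looseBox k a b c) w)
  conformal : ∃ g : JetSpace (k + 1) → ℝ, ∀ w ∈ looseBox k a b c, g w ≠ 0 ∧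
    ∀ v, contactForm (ψ w) (fderivWithin ℝ ψ (looseBox k a b c) w v) = g w * contactForm w v
  mem_iff : ∀ w ∈ looseBox k a b c, ψ w ∈ L ↔ w ∈ looseCylinder k b lam

/-- A subset `L ⊂ ℂ^{k+1} × ℝ` (in practice a Legendrian submanifold) is loose: some region `U`
of `ℂ^{k+1} × ℝ` is such that `(U, U ∩ L)` is contactomorphic to a standard loose chart
`(R^k_{abc}, Λ₀)` with `a < b c`. -/
def IsLoose {k : ℕ} (L : Set (JetSpace (k + 1))) : Prop :=
  ∃ a b c : ℝ, 0 < a ∧ 0 < b ∧ 0 < c ∧ a < b * c ∧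
    ∃ lam, IsModelArc a lam ∧ ∃ ψ, IsLooseChart a b c lam L ψ

/-- The translation by `s` of the last `x`-coordinate, a contactomorphism of `ℂ^{n+1} × ℝ`. -/
noncomputable def translateLast {n : ℕ} (s : ℝ) (w : JetSpace (n + 1)) : JetSpace (n + 1) :=
  (w.1 + EuclideanSpace.single (Fin.last n) s, w.2.1, w.2.2)

/-- Replace the last coordinate `u (Fin.last n)` of `u ∈ ℝ^{n+1}` by the vector
`u (Fin.last n) • θ ∈ ℝ^{m+1}`. -/
noncomputable def spinVec {n m : ℕ} (u : EuclideanSpace ℝ (Fin (n + 1)))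
    (θ : EuclideanSpace ℝ (Fin (m + 1))) : EuclideanSpace ℝ (Fin (n + m + 1)) :=
  WithLp.toLp 2 (Fin.append (m := n) (n := m + 1) (fun i => u i.castSucc)
    (fun j => u (Fin.last n) * θ j))

/-- The front `S^m`-spinning of `f : M → ℂ^{n+1} × ℝ`, a map `M × S^m → ℂ^{n+m+1} × ℝ`.  Its
front is `(x₀(p), …, x_{n-1}(p), x_n(p) θ, z(p))`, and the slopes
`(y₀(p), …, y_{n-1}(p), y_n(p) θ)` make it the Legendrian lift of this front. -/
noncomputable def frontSpin {M : Type*} {n : ℕ} (m : ℕ) (f : M → JetSpace (n + 1)) :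
    M × Metric.sphere (0 : EuclideanSpace ℝ (Fin (m + 1))) 1 → JetSpace (n + m + 1) :=
  fun q => (spinVec (f q.1).1 q.2, spinVec (f q.1).2.1 q.2, (f q.1).2.2)

/-! Write α for the contact form and r for the last x-coordinate. In spherical coordinates on the
spun block, the part of J¹(ℝⁿ⁺ᵐ⁺¹) where that block of the base is nonzero is J¹(ℝⁿ × ℝ_{>0}) ×
T*S^m, with contact form α minus the Liouville form of the sphere (`contactForm_fderiv_spinJet`).
There the spun Legendrian is Λ times the zero section, which also shows that it is an embedded
Legendrian (`isLegendrianEmbedding_frontSpin`).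

Central projection identifies an open hemisphere with all of ℝᵐ, so its cotangent lift gives a
contact embedding `spinChart` of J¹(ℝⁿ × ℝ_{>0}) × T*ℝᵐ with form α - p dq. If a loose chart ψ of Λ
has image in {r > 0} and ψ*α = g α, then (w, q, p) ↦ (ψ w, q, g(w) p) followed by `spinChart`
multiplies α - p dq by g. It is defined on the whole larger box, because T*ℝᵐ has no size
restriction. Hence a, b, c and the model arc do not change, and a < bc is kept
(`IsLooseChart.exists_frontSpin`).

The given chart may leave {r > 0} even though Λ does not. By compactness the translated Λ lies in {r
> ε} for some ε > 0. A diffeomorphism of ℝ onto its image in ℝ_{>0} that fixes [ε, ∞) lifts to a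
contact embedding `lastLift`, which pushes the chart into {r > 0} without moving the translated Λ.
-/

/-! ### Linear bookkeeping on Euclidean spaces -/

/-- The linear map `ℝᵇ → ℝᵃ` that pulls coordinates back along `σ`. -/
noncomputable def coordPullback {a b : ℕ} (σ : Fin a → Fin b) :
    EuclideanSpace ℝ (Fin b) →L[ℝ] EuclideanSpace ℝ (Fin a) :=
  LinearMap.toContinuousLinearMap
    { toFun := fun x => WithLp.toLp 2 fun i => x (σ i)
      map_add' := fun _ _ => by ext; simp
      map_smul' := fun _ _ => by ext; simp }

@[simp] lemma coordPullback_apply {a b : ℕ} (σ : Fin a → Fin b) (x : EuclideanSpace ℝ (Fin b))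
    (i : Fin a) : coordPullback σ x i = x (σ i) := rfl

/-- Replace the last coordinate of `u ∈ ℝⁿ⁺¹` by a vector of `ℝᵐ⁺¹`. -/
noncomputable def replaceLast (n m : ℕ) :
    (EuclideanSpace ℝ (Fin (n + 1)) × EuclideanSpace ℝ (Fin (m + 1))) →L[ℝ]
      EuclideanSpace ℝ (Fin (n + m + 1)) :=
  LinearMap.toContinuousLinearMap
    { toFun := fun x => WithLp.toLp 2
        (Fin.append (m := n) (n := m + 1) (fun i => x.1 i.castSucc) (fun j => x.2 j))
      map_add' := fun x y => by
        ext i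
        refine Fin.addCases (m := n) (n := m + 1) (fun i => ?_) (fun i => ?_) i <;> simp
      map_smul' := fun c x => by
        ext i
        refine Fin.addCases (m := n) (n := m + 1) (fun i => ?_) (fun i => ?_) i <;> simp }

/-- The index of the `i`-th unspun coordinate in `ℝⁿ⁺ᵐ⁺¹`. -/
def headIdx (n m : ℕ) (i : Fin n) : Fin (n + m + 1) := Fin.castAdd (m + 1) i

/-- The index of the `j`-th spun coordinate in `ℝⁿ⁺ᵐ⁺¹`. -/
def tailIdx (n m : ℕ) (j : Fin (m + 1)) : Fin (n + m + 1) := Fin.natAdd n j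

lemma sum_headIdx_tailIdx (n m : ℕ) (F : Fin (n + m + 1) → ℝ) :
    ∑ i, F i = ∑ i, F (headIdx n m i) + ∑ j, F (tailIdx n m j) :=
  Fin.sum_univ_add (a := n) (b := m + 1) F

@[simp] lemma replaceLast_headIdx {n m : ℕ}
    (x : EuclideanSpace ℝ (Fin (n + 1)) × EuclideanSpace ℝ (Fin (m + 1))) (i : Fin n) :
    replaceLast n m x (headIdx n m i) = x.1 i.castSucc :=
  Fin.append_left (m := n) (n := m + 1) (fun i => x.1 i.castSucc) (fun j => x.2 j) i

@[simp] lemma replaceLast_tailIdx {n m : ℕ}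
    (x : EuclideanSpace ℝ (Fin (n + 1)) × EuclideanSpace ℝ (Fin (m + 1))) (j : Fin (m + 1)) :
    replaceLast n m x (tailIdx n m j) = x.2 j :=
  Fin.append_right (m := n) (n := m + 1) (fun i => x.1 i.castSucc) (fun j => x.2 j) j

lemma spinVec_eq {n m : ℕ} (u : EuclideanSpace ℝ (Fin (n + 1)))
    (θ : EuclideanSpace ℝ (Fin (m + 1))) :
    spinVec u θ = replaceLast n m (u, u (Fin.last n) • θ) := rfl

lemma inner_eq_sum {d : ℕ} (x y : EuclideanSpace ℝ (Fin d)) : inner ℝ x y = ∑ i, x i * y i := by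
  simp [PiLp.inner_apply, mul_comm]

lemma contactForm_eq_inner {d : ℕ} (w v : JetSpace d) :
    contactForm w v = v.2.2 - inner ℝ w.2.1 v.1 := by
  rw [inner_eq_sum, contactForm]

lemma inner_replaceLast {n m : ℕ}
    (x y : EuclideanSpace ℝ (Fin (n + 1)) × EuclideanSpace ℝ (Fin (m + 1))) :
    inner ℝ (replaceLast n m x) (replaceLast n m y) =
      inner ℝ x.1 y.1 - x.1 (Fin.last n) * y.1 (Fin.last n) + inner ℝ x.2 y.2 := by
  simp only [inner_eq_sum]
  rw [sum_headIdx_tailIdx, Fin.sum_univ_castSucc (n := n)]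
  simp only [replaceLast_headIdx, replaceLast_tailIdx]
  ring

/-- Restore a last coordinate in place of the spun block. -/
noncomputable def restoreLast (n m : ℕ) :
    (EuclideanSpace ℝ (Fin (n + m + 1)) × ℝ) →L[ℝ] EuclideanSpace ℝ (Fin (n + 1)) :=
  LinearMap.toContinuousLinearMap
    { toFun := fun x => WithLp.toLp 2 (Fin.snoc (fun i => x.1 (headIdx n m i)) x.2)
      map_add' := fun x y => by
        ext i
        refine Fin.lastCases ?_ (fun i => ?_) i <;> simp
      map_smul' := fun c x => by
        ext i
        refine Fin.lastCases ?_ (fun i => ?_) i <;> simp }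

@[simp] lemma restoreLast_castSucc {n m : ℕ} (x : EuclideanSpace ℝ (Fin (n + m + 1)) × ℝ)
    (i : Fin n) : restoreLast n m x i.castSucc = x.1 (headIdx n m i) :=
  Fin.snoc_castSucc (α := fun _ => ℝ) x.2 (fun i => x.1 (headIdx n m i)) i

@[simp] lemma restoreLast_last {n m : ℕ} (x : EuclideanSpace ℝ (Fin (n + m + 1)) × ℝ) :
    restoreLast n m x (Fin.last n) = x.2 :=
  Fin.snoc_last (α := fun _ => ℝ) x.2 (fun i => x.1 (headIdx n m i))

lemma restoreLast_replaceLast {n m : ℕ} (u : EuclideanSpace ℝ (Fin (n + 1)))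
    (ξ : EuclideanSpace ℝ (Fin (m + 1))) :
    restoreLast n m (replaceLast n m (u, ξ), u (Fin.last n)) = u := by
  ext i
  refine Fin.lastCases ?_ (fun i => ?_) i <;> simp

/-- The spun block of coordinates. -/
noncomputable def spunBlock (n m : ℕ) :
    EuclideanSpace ℝ (Fin (n + m + 1)) →L[ℝ] EuclideanSpace ℝ (Fin (m + 1)) :=
  coordPullback (tailIdx n m)

@[simp] lemma spunBlock_replaceLast {n m : ℕ}
    (x : EuclideanSpace ℝ (Fin (n + 1)) × EuclideanSpace ℝ (Fin (m + 1))) :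
    spunBlock n m (replaceLast n m x) = x.2 := by
  ext j
  simp [spunBlock]

/-- Prepend a coordinate. -/
noncomputable def consVec (m : ℕ) :
    (ℝ × EuclideanSpace ℝ (Fin m)) →L[ℝ] EuclideanSpace ℝ (Fin (m + 1)) :=
  LinearMap.toContinuousLinearMap
    { toFun := fun x => WithLp.toLp 2 (Fin.cons x.1 (fun j => x.2 j))
      map_add' := fun x y => by
        ext i
        refine Fin.cases ?_ (fun i => ?_) i <;> simp
      map_smul' := fun c x => by
        ext i
        refine Fin.cases ?_ (fun i => ?_) i <;> simp }

@[simp] lemma consVec_zero {m : ℕ} (x : ℝ × EuclideanSpace ℝ (Fin m)) :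
    consVec m x 0 = x.1 := rfl

@[simp] lemma consVec_succ {m : ℕ} (x : ℝ × EuclideanSpace ℝ (Fin m)) (j : Fin m) :
    consVec m x j.succ = x.2 j := rfl

lemma inner_consVec {m : ℕ} (x y : ℝ × EuclideanSpace ℝ (Fin m)) :
    inner ℝ (consVec m x) (consVec m y) = x.1 * y.1 + inner ℝ x.2 y.2 := by
  simp [inner_eq_sum, Fin.sum_univ_succ]

/-- Forget the coordinate with index `0`. -/
noncomputable def dropZero (m : ℕ) :
    EuclideanSpace ℝ (Fin (m + 1)) →L[ℝ] EuclideanSpace ℝ (Fin m) :=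
  coordPullback Fin.succ

@[simp] lemma dropZero_consVec {m : ℕ} (x : ℝ × EuclideanSpace ℝ (Fin m)) :
    dropZero m (consVec m x) = x.2 := by
  ext j
  simp [dropZero]

/-! ### Spinning jets -/

/-- The jet over the point with spherical coordinates `(x₀, …, x_{n-1}, x_n, θ)` whose spun block
of slopes has radial part `y_n` and tangential part `ζ`. -/
noncomputable def spinJet (n m : ℕ)
    (a : JetSpace (n + 1) × EuclideanSpace ℝ (Fin (m + 1)) × EuclideanSpace ℝ (Fin (m + 1))) :
    JetSpace (n + m + 1) :=
  (replaceLast n m (a.1.1, a.1.1 (Fin.last n) • a.2.1),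
    replaceLast n m (a.1.2.1, a.1.2.1 (Fin.last n) • a.2.1 + a.2.2), a.1.2.2)

lemma frontSpin_eq_spinJet {M : Type*} {n : ℕ} (m : ℕ) (f : M → JetSpace (n + 1))
    (q : M × Metric.sphere (0 : EuclideanSpace ℝ (Fin (m + 1))) 1) :
    frontSpin m f q = spinJet n m (f q.1, q.2, 0) := by
  simp [frontSpin, spinJet, spinVec_eq]

lemma contDiff_spinJet (n m : ℕ) : ContDiff ℝ ∞ (spinJet n m) := by
  unfold spinJet
  fun_prop

/-- Since d(rθ) = r dθ + θ dr, the relations |θ| = 1, ζ ⊥ θ and θ ⊥ dθ reduce the pairing with y_n θ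
+ ζ to y_n dr + r⟨ζ, dθ⟩. At ζ = 0 this is the tangency of the spun Legendrian. -/
lemma contactForm_fderiv_spinJet {n m : ℕ}
    (a v : JetSpace (n + 1) × EuclideanSpace ℝ (Fin (m + 1)) × EuclideanSpace ℝ (Fin (m + 1)))
    (hθ : inner ℝ a.2.1 a.2.1 = (1 : ℝ)) (hθζ : inner ℝ a.2.2 a.2.1 = (0 : ℝ))
    (hv : inner ℝ a.2.1 v.2.1 = (0 : ℝ)) :
    contactForm (spinJet n m a) (fderiv ℝ (spinJet n m) a v) =
      contactForm a.1 v.1 - a.1.1 (Fin.last n) * inner ℝ a.2.2 v.2.1 := by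
  have hd : DifferentiableAt ℝ (spinJet n m) a :=
    (contDiff_spinJet n m).differentiable (by simp) a
  have h1 : (fderiv ℝ (spinJet n m) a v).1 = replaceLast n m
      (v.1.1, a.1.1 (Fin.last n) • v.2.1 + v.1.1 (Fin.last n) • a.2.1) := by
    let L : JetSpace (n + 1) × EuclideanSpace ℝ (Fin (m + 1)) × EuclideanSpace ℝ (Fin (m + 1))
        →L[ℝ] ℝ := (EuclideanSpace.proj (Fin.last n)).comp
          ((ContinuousLinearMap.fst ℝ _ _).comp (ContinuousLinearMap.fst ℝ _ _))
    have hl : HasFDerivAt L L a := L.hasFDerivAt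
    have h := (replaceLast n m).hasFDerivAt.comp a
      (((hasFDerivAt_fst (p := a)).fst).prodMk (hl.smul (hasFDerivAt_snd (p := a)).fst))
    exact DFunLike.congr_fun (hd.hasFDerivAt.fst.unique h) v
  have h2 : (fderiv ℝ (spinJet n m) a v).2.2 = v.1.2.2 := by
    have h : HasFDerivAt (fun a => (spinJet n m a).2.2) _ a := hd.hasFDerivAt.snd.snd
    have h' := (hasFDerivAt_fst (p := a) (𝕜 := ℝ)).snd.snd
    exact DFunLike.congr_fun (h.unique h') v
  rw [contactForm_eq_inner, contactForm_eq_inner, h1, h2, spinJet, inner_replaceLast]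
  simp only [inner_add_left, inner_add_right, real_inner_smul_left, real_inner_smul_right, hθ,
    hθζ, hv]
  ring

/-- The inverse of `spinJet`, on the region where the spun block of the front is nonzero. -/
noncomputable def unspinJet (n m : ℕ) (w : JetSpace (n + m + 1)) :
    JetSpace (n + 1) × EuclideanSpace ℝ (Fin (m + 1)) × EuclideanSpace ℝ (Fin (m + 1)) :=
  let X := spunBlock n m w.1
  let Y := spunBlock n m w.2.1
  ((restoreLast n m (w.1, ‖X‖), restoreLast n m (w.2.1, inner ℝ Y X * ‖X‖⁻¹), w.2.2),
    ‖X‖⁻¹ • X, Y - (inner ℝ Y X * ‖X‖⁻¹ * ‖X‖⁻¹) • X)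

/-- Positivity of r makes it the norm of the spun block, which excludes the ambiguity (r, θ) ~ (-r,
-θ). As ζ ⊥ θ, the slope y_n is the component of the slope block along θ, and ζ is the rest. -/
lemma unspinJet_spinJet {n m : ℕ}
    {a : JetSpace (n + 1) × EuclideanSpace ℝ (Fin (m + 1)) × EuclideanSpace ℝ (Fin (m + 1))}
    (hr : 0 < a.1.1 (Fin.last n)) (hθ : inner ℝ a.2.1 a.2.1 = (1 : ℝ))
    (hθζ : inner ℝ a.2.2 a.2.1 = (0 : ℝ)) : unspinJet n m (spinJet n m a) = a := by
  obtain ⟨⟨x, y, z⟩, θ, ζ⟩ := a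
  simp only at hr hθ hθζ
  have hθ1 : ‖θ‖ = 1 := by
    rw [real_inner_self_eq_norm_sq] at hθ
    nlinarith [norm_nonneg θ]
  have hX : ‖x (Fin.last n) • θ‖ = x (Fin.last n) := by
    rw [norm_smul, hθ1, Real.norm_of_nonneg hr.le, mul_one]
  have hYX : inner ℝ (y (Fin.last n) • θ + ζ) (x (Fin.last n) • θ) =
      y (Fin.last n) * x (Fin.last n) := by
    simp only [inner_add_left, real_inner_smul_left, real_inner_smul_right, hθ, hθζ]
    ring
  have h0 : x (Fin.last n) ≠ 0 := hr.ne'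
  simp only [unspinJet, spinJet, spunBlock_replaceLast, hX, hYX, mul_inv_cancel_right₀ h0,
    restoreLast_replaceLast, smul_smul, inv_mul_cancel₀ h0, one_smul, inv_mul_cancel_right₀ h0,
    add_sub_cancel_left]

lemma differentiableAt_unspinJet {n m : ℕ} {w : JetSpace (n + m + 1)}
    (hw : spunBlock n m w.1 ≠ 0) : DifferentiableAt ℝ (unspinJet n m) w := by
  have hn : DifferentiableAt ℝ (fun w : JetSpace (n + m + 1) => ‖spunBlock n m w.1‖) w := by
    exact (spunBlock n m).differentiableAt.comp w differentiableAt_fst |>.norm ℝ hw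
  have hi : DifferentiableAt ℝ (fun w : JetSpace (n + m + 1) => ‖spunBlock n m w.1‖⁻¹) w :=
    hn.inv (norm_ne_zero_iff.2 hw)
  have hin : DifferentiableAt ℝ (fun w : JetSpace (n + m + 1) =>
      inner ℝ (spunBlock n m w.2.1) (spunBlock n m w.1)) w :=
    DifferentiableAt.inner ℝ (by fun_prop) (by fun_prop)
  refine ((((restoreLast n m).differentiableAt.comp w ?_).prodMk
    (((restoreLast n m).differentiableAt.comp w ?_).prodMk ?_))).prodMk (.prodMk ?_ ?_) <;> fun_prop

lemma spunBlock_spinJet_ne_zero {n m : ℕ}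
    {a : JetSpace (n + 1) × EuclideanSpace ℝ (Fin (m + 1)) × EuclideanSpace ℝ (Fin (m + 1))}
    (hr : 0 < a.1.1 (Fin.last n)) (hθ : inner ℝ a.2.1 a.2.1 = (1 : ℝ)) :
    spunBlock n m (spinJet n m a).1 ≠ 0 := by
  rw [spinJet, spunBlock_replaceLast]
  refine smul_ne_zero hr.ne' fun h => ?_
  simp [h] at hθ

/-! ### The spinning of a Legendrian embedding -/

lemma inner_self_coe_sphere {m : ℕ} (θ : Metric.sphere (0 : EuclideanSpace ℝ (Fin (m + 1))) 1) :
    inner ℝ (θ : EuclideanSpace ℝ (Fin (m + 1))) (θ : EuclideanSpace ℝ (Fin (m + 1))) = (1 : ℝ) := by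
  simp

theorem isLegendrianEmbedding_frontSpin {n : ℕ} (m : ℕ) {M : Type*} [TopologicalSpace M]
    [ChartedSpace (EuclideanSpace ℝ (Fin (n + 1))) M] [IsManifold (𝓡 (n + 1)) ∞ M]
    [CompactSpace M] {f : M → JetSpace (n + 1)} (hf : IsLegendrianEmbedding (𝓡 (n + 1)) f)
    (hpos : ∀ p, 0 < (f p).1 (Fin.last n)) :
    IsLegendrianEmbedding ((𝓡 (n + 1)).prod (𝓡 m)) (frontSpin m f) := by
  have : Fact (Module.finrank ℝ (EuclideanSpace ℝ (Fin (m + 1))) = m + 1) := ⟨by simp⟩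
  let a : M × Metric.sphere (0 : EuclideanSpace ℝ (Fin (m + 1))) 1 →
      JetSpace (n + 1) × EuclideanSpace ℝ (Fin (m + 1)) × EuclideanSpace ℝ (Fin (m + 1)) :=
    fun q => (f q.1, q.2, 0)
  have hfs : frontSpin m f = spinJet n m ∘ a := funext fun q => frontSpin_eq_spinJet m f q
  have hinv (q) : unspinJet n m (frontSpin m f q) = a q := by
    rw [hfs]
    exact unspinJet_spinJet (a := a q) (hpos q.1) (inner_self_coe_sphere q.2) (by simp [a])
  have hsm : ContMDiff (𝓡 m) 𝓘(ℝ, EuclideanSpace ℝ (Fin (m + 1))) ∞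
      (Subtype.val : Metric.sphere (0 : EuclideanSpace ℝ (Fin (m + 1))) 1 → _) := contMDiff_coe_sphere
  have ha : ContMDiff ((𝓡 (n + 1)).prod (𝓡 m)) 𝓘(ℝ, JetSpace (n + 1) ×
      EuclideanSpace ℝ (Fin (m + 1)) × EuclideanSpace ℝ (Fin (m + 1))) ∞ a :=
    (hf.contMDiff.comp contMDiff_fst).prodMk_space
      ((hsm.comp contMDiff_snd).prodMk_space contMDiff_const)
  have hfsm : ContMDiff ((𝓡 (n + 1)).prod (𝓡 m)) 𝓘(ℝ, JetSpace (n + m + 1)) ∞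
      (frontSpin m f) := hfs ▸ (contDiff_spinJet n m).contMDiff.comp ha
  have hda (q) : HasMFDerivAt ((𝓡 (n + 1)).prod (𝓡 m)) 𝓘(ℝ, JetSpace (n + 1) ×
      EuclideanSpace ℝ (Fin (m + 1)) × EuclideanSpace ℝ (Fin (m + 1))) a q
      (((mfderiv (𝓡 (n + 1)) 𝓘(ℝ, JetSpace (n + 1)) f q.1).comp
        (ContinuousLinearMap.fst ℝ (EuclideanSpace ℝ (Fin (n + 1))) (EuclideanSpace ℝ (Fin m)))).prod
        (((mfderiv (𝓡 m) 𝓘(ℝ, EuclideanSpace ℝ (Fin (m + 1)))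
          (Subtype.val : Metric.sphere (0 : EuclideanSpace ℝ (Fin (m + 1))) 1 → _) q.2).comp
        (ContinuousLinearMap.snd ℝ (EuclideanSpace ℝ (Fin (n + 1)))
          (EuclideanSpace ℝ (Fin m)))).prod 0)) := by
    have h1 := ((hf.contMDiff q.1).mdifferentiableAt (by simp)).hasMFDerivAt.comp q
      (hasMFDerivAt_fst (I := 𝓡 (n + 1)) (I' := 𝓡 m) q)
    have h2 := ((hsm q.2).mdifferentiableAt (by simp)).hasMFDerivAt.comp q
      (hasMFDerivAt_snd (I := 𝓡 (n + 1)) (I' := 𝓡 m) q)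
    have h3 := hasMFDerivAt_const (I := (𝓡 (n + 1)).prod (𝓡 m))
      (I' := 𝓘(ℝ, EuclideanSpace ℝ (Fin (m + 1)))) (0 : EuclideanSpace ℝ (Fin (m + 1))) q
    exact ⟨h1.1.prodMk (h2.1.prodMk h3.1), h1.2.prodMk (h2.2.prodMk h3.2)⟩
  refine ⟨by simp; omega, hfsm, fun q => ?_, ?_, fun q v => ?_⟩
  -- Immersion: `unspinJet` is a differentiable left inverse, so a kernel vector is killed by the
  -- derivatives of `f` and of the inclusion of the sphere.
  · have hG : HasMFDerivAt 𝓘(ℝ, JetSpace (n + m + 1)) 𝓘(ℝ, JetSpace (n + 1) ×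
        EuclideanSpace ℝ (Fin (m + 1)) × EuclideanSpace ℝ (Fin (m + 1))) (unspinJet n m)
        (frontSpin m f q) (fderiv ℝ (unspinJet n m) (frontSpin m f q)) := by
      refine (differentiableAt_unspinJet ?_).hasFDerivAt.hasMFDerivAt
      rw [hfs]
      exact spunBlock_spinJet_ne_zero (hpos q.1) (inner_self_coe_sphere q.2)
    have hc := hG.comp q ((hfsm q).mdifferentiableAt (by simp)).hasMFDerivAt
    rw [show unspinJet n m ∘ frontSpin m f = a from funext hinv] at hc
    have he := hasMFDerivAt_unique hc (hda q)
    refine (injective_iff_map_eq_zero _).2 fun v hv => ?_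
    have h0 := (DFunLike.congr_fun he v).symm.trans
      ((congrArg (fderiv ℝ (unspinJet n m) (frontSpin m f q)) hv).trans (map_zero _))
    have h1 := congrArg Prod.fst h0
    have h2 := congrArg (fun x => x.2.1) h0
    exact Prod.ext ((injective_iff_map_eq_zero _).1 (hf.injective_mfderiv q.1) _ h1)
      ((injective_iff_map_eq_zero _).1 (injective_mvfderiv_subtypeVal_sphere q.2) _ h2)
  · refine (hfsm.continuous.isClosedEmbedding fun q q' h => ?_).isEmbedding
    have h1 : a q = a q' := by rw [← hinv, ← hinv, h]
    simp only [a, Prod.mk.injEq] at h1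
    exact Prod.ext (hf.isEmbedding.injective h1.1) (Subtype.ext h1.2.1)
  · have hS : HasMFDerivAt 𝓘(ℝ, JetSpace (n + 1) ×
        EuclideanSpace ℝ (Fin (m + 1)) × EuclideanSpace ℝ (Fin (m + 1)))
        𝓘(ℝ, JetSpace (n + m + 1)) (spinJet n m) (a q) (fderiv ℝ (spinJet n m) (a q)) :=
      ((contDiff_spinJet n m).differentiable (by simp) _).hasFDerivAt.hasMFDerivAt
    have hc := hS.comp q (hda q)
    rw [← hfs] at hc
    rw [hc.mfderiv, hfs]
    -- The tangent space of the sphere at θ is the orthogonal complement of θ.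
    have hort : inner ℝ (q.2 : EuclideanSpace ℝ (Fin (m + 1)))
        (mfderiv (𝓡 m) 𝓘(ℝ, EuclideanSpace ℝ (Fin (m + 1)))
          (Subtype.val : Metric.sphere (0 : EuclideanSpace ℝ (Fin (m + 1))) 1 → _) q.2 v.2 :
          EuclideanSpace ℝ (Fin (m + 1))) = (0 : ℝ) := by
      have hr := range_mvfderiv_subtypeVal (n := m) q.2
      exact Submodule.mem_orthogonal_singleton_iff_inner_right.1 (hr ▸ ⟨v.2, rfl⟩)
    refine (contactForm_fderiv_spinJet (a q) _ (inner_self_coe_sphere q.2) (by simp [a])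
      hort).trans ?_
    refine (congrArg₂ (· - ·) (hf.tangent q.1 v.1) ?_).trans (sub_zero 0)
    simp [a]

/-! ### Central projection coordinates on the sphere and its cotangent bundle -/

/-- The norm of `(1, q)`. -/
noncomputable def centralNorm {m : ℕ} (q : EuclideanSpace ℝ (Fin m)) : ℝ := √(1 + ‖q‖ ^ 2)

lemma centralNorm_pos {m : ℕ} (q : EuclideanSpace ℝ (Fin m)) : 0 < centralNorm q := by
  unfold centralNorm
  positivity

lemma centralNorm_sq {m : ℕ} (q : EuclideanSpace ℝ (Fin m)) :
    centralNorm q ^ 2 = 1 + ‖q‖ ^ 2 :=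
  Real.sq_sqrt (by positivity)

lemma contDiff_centralNorm (m : ℕ) :
    ContDiff ℝ ∞ (centralNorm : EuclideanSpace ℝ (Fin m) → ℝ) :=
  ContDiff.sqrt (contDiff_const.add (contDiff_id.norm_sq ℝ)) fun q => by positivity

/-- The point of the unit sphere on the ray through `(1, q)`. -/
noncomputable def centralProj {m : ℕ} (q : EuclideanSpace ℝ (Fin m)) :
    EuclideanSpace ℝ (Fin (m + 1)) :=
  (centralNorm q)⁻¹ • consVec m (1, q)

lemma inner_centralProj_self {m : ℕ} (q : EuclideanSpace ℝ (Fin m)) :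
    inner ℝ (centralProj q) (centralProj q) = (1 : ℝ) := by
  have h := (centralNorm_pos q).ne'
  rw [centralProj, real_inner_smul_left, real_inner_smul_right, inner_consVec,
    real_inner_self_eq_norm_sq, mul_one, ← centralNorm_sq]
  field_simp

lemma contDiff_centralProj (m : ℕ) :
    ContDiff ℝ ∞ (centralProj : EuclideanSpace ℝ (Fin m) → _) := by
  have h : ContDiff ℝ ∞ fun q : EuclideanSpace ℝ (Fin m) => (centralNorm q)⁻¹ :=
    (contDiff_centralNorm m).inv fun q => (centralNorm_pos q).ne'
  exact h.smul ((consVec m).contDiff.comp (contDiff_const.prodMk contDiff_id))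

/-- The covector at `(1, q)` that restricts to `p` and vanishes on the ray. -/
noncomputable def centralCovec {m : ℕ} (q p : EuclideanSpace ℝ (Fin m)) :
    EuclideanSpace ℝ (Fin (m + 1)) :=
  consVec m (-inner ℝ p q, p)

lemma inner_centralCovec_centralProj {m : ℕ} (q p : EuclideanSpace ℝ (Fin m)) :
    inner ℝ (centralCovec q p) (centralProj q) = (0 : ℝ) := by
  rw [centralProj, centralCovec, real_inner_smul_right, inner_consVec]
  simp

/-- The derivative of (1, q)/N, with N the central norm, is (0, v)/N plus a multiple of (1, q). The
covector kills the multiple, and the factor N undoes the scaling. -/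
lemma inner_centralCovec_fderiv_centralProj {m : ℕ} (q p v : EuclideanSpace ℝ (Fin m)) :
    centralNorm q * inner ℝ (centralCovec q p) (fderiv ℝ centralProj q v) = inner ℝ p v := by
  have h : DifferentiableAt ℝ (fun q : EuclideanSpace ℝ (Fin m) => (centralNorm q)⁻¹) q :=
    (((contDiff_centralNorm m).inv fun q => (centralNorm_pos q).ne').differentiable (by simp)) q
  have h2 := h.hasFDerivAt.smul ((consVec m).hasFDerivAt.comp q
    ((hasFDerivAt_const (1 : ℝ) q).prodMk (hasFDerivAt_id q)))
  have h3 : fderiv ℝ centralProj q v = (centralNorm q)⁻¹ • consVec m (0, v) +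
      (fderiv ℝ (fun q : EuclideanSpace ℝ (Fin m) => (centralNorm q)⁻¹) q v) •
        consVec m (1, q) :=
    DFunLike.congr_fun h2.fderiv v
  have h0 := (centralNorm_pos q).ne'
  rw [h3, centralCovec, inner_add_right, real_inner_smul_right, real_inner_smul_right,
    inner_consVec, inner_consVec]
  field_simp
  ring

lemma inner_centralProj_fderiv_centralProj {m : ℕ} (q v : EuclideanSpace ℝ (Fin m)) :
    inner ℝ (centralProj q) (fderiv ℝ centralProj q v) = (0 : ℝ) := by
  have hd : HasFDerivAt centralProj (fderiv ℝ centralProj q) q :=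
    ((contDiff_centralProj m).differentiable (by simp) q).hasFDerivAt
  have h := hd.inner ℝ hd
  simp only [inner_centralProj_self] at h
  have h1 := DFunLike.congr_fun (h.unique (hasFDerivAt_const (1 : ℝ) q)) v
  simp [real_inner_comm] at h1
  rw [real_inner_comm] at h1 ⊢
  linarith

/-- The coordinates `(w, θ, ζ)` of the jet with spherical coordinates `w` and cotangent coordinates
`(q, p)` on the sphere. -/
noncomputable def sphericalJet (n m : ℕ)
    (b : JetSpace (n + 1) × EuclideanSpace ℝ (Fin m) × EuclideanSpace ℝ (Fin m)) :
    JetSpace (n + 1) × EuclideanSpace ℝ (Fin (m + 1)) × EuclideanSpace ℝ (Fin (m + 1)) :=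
  (b.1, centralProj b.2.1,
    (centralNorm b.2.1 * (b.1.1 (Fin.last n))⁻¹) • centralCovec b.2.1 b.2.2)

lemma contDiffAt_sphericalJet {n m : ℕ}
    {b : JetSpace (n + 1) × EuclideanSpace ℝ (Fin m) × EuclideanSpace ℝ (Fin m)}
    (hr : 0 < b.1.1 (Fin.last n)) : ContDiffAt ℝ ∞ (sphericalJet n m) b := by
  have h1 : ContDiffAt ℝ ∞ (fun b : JetSpace (n + 1) × EuclideanSpace ℝ (Fin m) ×
      EuclideanSpace ℝ (Fin m) => (b.1.1 (Fin.last n))⁻¹) b :=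
    ContDiffAt.inv (by fun_prop) hr.ne'
  have h2 : ContDiffAt ℝ ∞ (fun b : JetSpace (n + 1) × EuclideanSpace ℝ (Fin m) ×
      EuclideanSpace ℝ (Fin m) => centralNorm b.2.1) b :=
    (contDiff_centralNorm m).contDiffAt.comp b contDiff_snd.fst.contDiffAt
  have h3 : ContDiffAt ℝ ∞ (fun b : JetSpace (n + 1) × EuclideanSpace ℝ (Fin m) ×
      EuclideanSpace ℝ (Fin m) => centralProj b.2.1) b :=
    (contDiff_centralProj m).contDiffAt.comp b contDiff_snd.fst.contDiffAt
  have h4 : ContDiffAt ℝ ∞ (fun b : JetSpace (n + 1) × EuclideanSpace ℝ (Fin m) ×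
      EuclideanSpace ℝ (Fin m) => centralCovec b.2.1 b.2.2) b :=
    (consVec m).contDiff.contDiffAt.comp b
      (((contDiff_snd.snd.inner ℝ contDiff_snd.fst).neg.prodMk contDiff_snd.snd).contDiffAt)
  exact contDiffAt_fst.prodMk (h3.prodMk ((h2.mul h1).smul h4))

/-- The inverse of `sphericalJet`. -/
noncomputable def cartesianJet (n m : ℕ)
    (a : JetSpace (n + 1) × EuclideanSpace ℝ (Fin (m + 1)) × EuclideanSpace ℝ (Fin (m + 1))) :
    JetSpace (n + 1) × EuclideanSpace ℝ (Fin m) × EuclideanSpace ℝ (Fin m) :=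
  (a.1, (a.2.1 0)⁻¹ • dropZero m a.2.1, (a.1.1 (Fin.last n) * a.2.1 0) • dropZero m a.2.2)

/-- The coordinate of θ with index 0 is 1/N, which is nonzero. Hence q is recovered as a quotient,
and p from the remaining entries of ζ after removing the factor N/r. -/
lemma cartesianJet_sphericalJet {n m : ℕ}
    {b : JetSpace (n + 1) × EuclideanSpace ℝ (Fin m) × EuclideanSpace ℝ (Fin m)}
    (hr : 0 < b.1.1 (Fin.last n)) : cartesianJet n m (sphericalJet n m b) = b := by
  obtain ⟨w, q, p⟩ := b
  have h := (centralNorm_pos q).ne'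
  have hr' := hr.ne'
  simp only at hr'
  have h0 : centralProj q 0 = (centralNorm q)⁻¹ := by simp [centralProj]
  simp only [cartesianJet, sphericalJet, h0]
  simp only [centralProj, centralCovec, map_smul, dropZero_consVec, smul_smul]
  congr 2
  · field_simp
    simp
  · field_simp
    simp

lemma differentiableAt_cartesianJet {n m : ℕ}
    {a : JetSpace (n + 1) × EuclideanSpace ℝ (Fin (m + 1)) × EuclideanSpace ℝ (Fin (m + 1))}
    (ha : a.2.1 0 ≠ 0) : DifferentiableAt ℝ (cartesianJet n m) a := by
  have h1 : DifferentiableAt ℝ (fun a : JetSpace (n + 1) × EuclideanSpace ℝ (Fin (m + 1)) ×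
      EuclideanSpace ℝ (Fin (m + 1)) => (a.2.1 0)⁻¹) a :=
    DifferentiableAt.inv (by fun_prop) ha
  unfold cartesianJet
  fun_prop

/-! ### The cotangent lift of the spherical coordinates -/

/-- The contact embedding `J¹(ℝⁿ × ℝ_{>0}) × T*ℝᵐ → J¹(ℝⁿ⁺ᵐ⁺¹)` that lifts the central
projection coordinates on the base. -/
noncomputable def spinChart (n m : ℕ) :
    JetSpace (n + 1) × EuclideanSpace ℝ (Fin m) × EuclideanSpace ℝ (Fin m) →
      JetSpace (n + m + 1) :=
  spinJet n m ∘ sphericalJet n m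

lemma inner_sphericalJet {n m : ℕ}
    (b : JetSpace (n + 1) × EuclideanSpace ℝ (Fin m) × EuclideanSpace ℝ (Fin m)) :
    inner ℝ (sphericalJet n m b).2.2 (sphericalJet n m b).2.1 = (0 : ℝ) := by
  simp only [sphericalJet]
  rw [real_inner_smul_left, inner_centralCovec_centralProj, mul_zero]

lemma contDiffAt_spinChart {n m : ℕ}
    {b : JetSpace (n + 1) × EuclideanSpace ℝ (Fin m) × EuclideanSpace ℝ (Fin m)}
    (hr : 0 < b.1.1 (Fin.last n)) : ContDiffAt ℝ ∞ (spinChart n m) b :=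
  (contDiff_spinJet n m).contDiffAt.comp b (contDiffAt_sphericalJet hr)

lemma unspinJet_spinChart {n m : ℕ}
    {b : JetSpace (n + 1) × EuclideanSpace ℝ (Fin m) × EuclideanSpace ℝ (Fin m)}
    (hr : 0 < b.1.1 (Fin.last n)) : unspinJet n m (spinChart n m b) = sphericalJet n m b :=
  unspinJet_spinJet (a := sphericalJet n m b) hr (inner_centralProj_self b.2.1)
    (inner_sphericalJet b)

lemma cartesianJet_unspinJet_spinChart {n m : ℕ}
    {b : JetSpace (n + 1) × EuclideanSpace ℝ (Fin m) × EuclideanSpace ℝ (Fin m)}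
    (hr : 0 < b.1.1 (Fin.last n)) :
    cartesianJet n m (unspinJet n m (spinChart n m b)) = b := by
  rw [unspinJet_spinChart hr, cartesianJet_sphericalJet hr]

lemma injective_fderiv_spinChart {n m : ℕ}
    {b : JetSpace (n + 1) × EuclideanSpace ℝ (Fin m) × EuclideanSpace ℝ (Fin m)}
    (hr : 0 < b.1.1 (Fin.last n)) : Function.Injective (fderiv ℝ (spinChart n m) b) := by
  have hd : HasFDerivAt (spinChart n m) _ b :=
    ((contDiffAt_spinChart hr).differentiableAt (by simp)).hasFDerivAt
  have hu : DifferentiableAt ℝ (unspinJet n m) (spinChart n m b) :=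
    differentiableAt_unspinJet (spunBlock_spinJet_ne_zero (a := sphericalJet n m b) hr
      (inner_centralProj_self b.2.1))
  have hc : DifferentiableAt ℝ (cartesianJet n m) (unspinJet n m (spinChart n m b)) := by
    rw [unspinJet_spinChart hr]
    refine differentiableAt_cartesianJet ?_
    simp [sphericalJet, centralProj, (centralNorm_pos b.2.1).ne']
  have hG := (hc.hasFDerivAt.comp _ hu.hasFDerivAt).comp b hd
  -- The left inverse is valid on r > 0, an open condition, so it may be differentiated at `b`.
  have hev : (cartesianJet n m ∘ unspinJet n m) ∘ spinChart n m =ᶠ[𝓝 b] id := by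
    have : ContinuousAt (fun b : JetSpace (n + 1) × EuclideanSpace ℝ (Fin m) ×
      EuclideanSpace ℝ (Fin m) => b.1.1 (Fin.last n)) b := by fun_prop
    filter_upwards [this.eventually (lt_mem_nhds hr)] with b' hb'
    exact cartesianJet_unspinJet_spinChart hb'
  have he := (hG.congr_of_eventuallyEq hev.symm).unique (hasFDerivAt_id b)
  intro v v' h
  have h1 (v) := DFunLike.congr_fun he v
  simp only [ContinuousLinearMap.comp_apply] at h1
  rw [← ContinuousLinearMap.id_apply (R₁ := ℝ) v, ← h1, h, h1, ContinuousLinearMap.id_apply]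

/-- The factor N/r in ζ is chosen so that r⟨ζ, dθ⟩ becomes p dq: the 1/r cancels r, and N cancels
the scaling of the central projection. -/
lemma contactForm_fderiv_spinChart {n m : ℕ}
    {b : JetSpace (n + 1) × EuclideanSpace ℝ (Fin m) × EuclideanSpace ℝ (Fin m)}
    (hr : 0 < b.1.1 (Fin.last n))
    (v : JetSpace (n + 1) × EuclideanSpace ℝ (Fin m) × EuclideanSpace ℝ (Fin m)) :
    contactForm (spinChart n m b) (fderiv ℝ (spinChart n m) b v) =
      contactForm b.1 v.1 - inner ℝ b.2.2 v.2.1 := by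
  have hs : HasFDerivAt (sphericalJet n m) (fderiv ℝ (sphericalJet n m) b) b :=
    ((contDiffAt_sphericalJet hr).differentiableAt (by simp)).hasFDerivAt
  have h1 : (fderiv ℝ (sphericalJet n m) b v).1 = v.1 :=
    DFunLike.congr_fun (hs.fst.unique hasFDerivAt_fst) v
  have h2 : (fderiv ℝ (sphericalJet n m) b v).2.1 = fderiv ℝ centralProj b.2.1 v.2.1 := by
    have hc : HasFDerivAt (centralProj ∘ fun b : JetSpace (n + 1) × EuclideanSpace ℝ (Fin m) ×
        EuclideanSpace ℝ (Fin m) => b.2.1) _ b :=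
      ((contDiff_centralProj m).differentiable (by simp) b.2.1).hasFDerivAt.comp b
        (hasFDerivAt_snd (p := b)).fst
    exact DFunLike.congr_fun (hs.snd.fst.unique hc) v
  have h3 : fderiv ℝ (spinChart n m) b v =
      fderiv ℝ (spinJet n m) (sphericalJet n m b) (fderiv ℝ (sphericalJet n m) b v) := by
    rw [spinChart, fderiv_comp b ((contDiff_spinJet n m).differentiable (by simp) _)
      hs.differentiableAt]
    rfl
  rw [h3]
  refine (contactForm_fderiv_spinJet _ _ (inner_centralProj_self b.2.1) (inner_sphericalJet b)
    ?_).trans ?_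
  · rw [h2]
    exact inner_centralProj_fderiv_centralProj _ _
  · rw [h1, h2]
    simp only [sphericalJet]
    rw [real_inner_smul_left, ← inner_centralCovec_fderiv_centralProj b.2.1 b.2.2 v.2.1]
    have := hr.ne'
    field_simp

/-! ### Pushing the last coordinate into the positive half-line -/

/-- There is a diffeomorphism of `ℝ` into `ℝ_{>0}` that fixes `[ε, ∞)`. -/
lemma exists_contDiff_pos_eq_self {ε : ℝ} (hε : 0 < ε) :
    ∃ h : ℝ → ℝ, ContDiff ℝ ∞ h ∧ (∀ x, 0 < deriv h x) ∧ (∀ x, 0 < h x) ∧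
      ∀ x, ε ≤ x → h x = x := by
  -- The map is φ x + (1 - φ) g. Here φ rises from 0 at ε/2 to 1 at ε, and g is increasing with
  -- values in (0, ε/2).
  let φ : ℝ → ℝ := fun x => Real.smoothTransition (2 / ε * x - 1)
  let g : ℝ → ℝ := fun x => ε / (2 * Real.pi) * Real.arctan x + ε / 4
  have hφ : ContDiff ℝ ∞ φ := Real.smoothTransition.contDiff.comp (by fun_prop)
  have hφm : Monotone φ := Real.smoothTransition.monotone.comp fun x y hxy => by
    have : 0 < 2 / ε := by positivity
    exact sub_le_sub_right (mul_le_mul_of_nonneg_left hxy this.le) 1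
  have hφ0 (x) (hx : x ≤ ε / 2) : φ x = 0 := by
    refine Real.smoothTransition.zero_of_nonpos ?_
    rw [div_mul_eq_mul_div, sub_nonpos, div_le_one hε]
    linarith
  have hφ1 (x) (hx : ε ≤ x) : φ x = 1 := by
    refine Real.smoothTransition.one_of_one_le ?_
    rw [div_mul_eq_mul_div, le_sub_iff_add_le, le_div_iff₀ hε]
    linarith
  have hφle (x) : φ x ≤ 1 := Real.smoothTransition.le_one _
  have hφnn (x) : 0 ≤ φ x := Real.smoothTransition.nonneg _
  have hg : ContDiff ℝ ∞ g := (contDiff_const.mul Real.contDiff_arctan).add contDiff_const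
  have hpi := Real.pi_pos
  have hc : 0 < ε / (2 * Real.pi) := by positivity
  have hcpi : ε / (2 * Real.pi) * (Real.pi / 2) = ε / 4 := by field_simp; norm_num
  have hgpos (x) : 0 < g x := by
    have := mul_lt_mul_of_pos_left (Real.neg_pi_div_two_lt_arctan x) hc
    simp only [g]
    linarith
  have hglt (x) : g x < ε / 2 := by
    have := mul_lt_mul_of_pos_left (Real.arctan_lt_pi_div_two x) hc
    simp only [g]
    linarith
  have hd (x) : HasDerivAt (fun x => φ x * x + (1 - φ x) * g x)
      ((deriv φ x * x + φ x * 1) + (-deriv φ x * g x + (1 - φ x) *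
        (ε / (2 * Real.pi) * (1 / (1 + x ^ 2))))) x := by
    have h1 : HasDerivAt φ (deriv φ x) x := (hφ.differentiable (by simp) x).hasDerivAt
    have h2 : HasDerivAt g (ε / (2 * Real.pi) * (1 / (1 + x ^ 2))) x :=
      ((Real.hasDerivAt_arctan x).const_mul _).add_const _
    exact (h1.mul (hasDerivAt_id x)).add ((h1.const_sub 1).mul h2)
  refine ⟨fun x => φ x * x + (1 - φ x) * g x, by fun_prop, fun x => ?_, fun x => ?_,
    fun x hx => by simp [hφ1 x hx]⟩
  · rw [(hd x).deriv]
    -- The derivative is φ'(x - g) + φ + (1 - φ) g'. Its first term is nonnegative because φ'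
    -- vanishes below ε/2, while g < ε/2 ≤ x elsewhere.
    have h1 : 0 ≤ deriv φ x * (x - g x) := by
      rcases lt_or_ge x (ε / 2) with hx | hx
      · have : φ =ᶠ[𝓝 x] fun _ => 0 := by
          filter_upwards [Iio_mem_nhds hx] with y hy using hφ0 y hy.le
        simp [this.deriv_eq]
      · exact mul_nonneg hφm.deriv_nonneg (by linarith [hglt x])
    have h2 : 0 < ε / (2 * Real.pi) * (1 / (1 + x ^ 2)) := by positivity
    rcases (hφnn x).eq_or_lt with h | h
    · rw [← h] at *
      linarith
    · linarith [mul_nonneg (sub_nonneg.2 (hφle x)) h2.le]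
  · rcases le_total x (ε / 2) with hx | hx
    · simpa [hφ0 x hx] using hgpos x
    · have hx0 : 0 < x := by linarith
      rcases (hφnn x).eq_or_lt with h | h
      · simpa [← h] using hgpos x
      · linarith [mul_pos h hx0, mul_nonneg (sub_nonneg.2 (hφle x)) (hgpos x).le]

/-- The contact lift of the change `h` of the last `x`-coordinate. -/
noncomputable def lastLift {n : ℕ} (h : ℝ → ℝ) (w : JetSpace (n + 1)) : JetSpace (n + 1) :=
  (w.1 + (h (w.1 (Fin.last n)) - w.1 (Fin.last n)) • EuclideanSpace.single (Fin.last n) 1,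
    w.2.1 + (w.2.1 (Fin.last n) * (deriv h (w.1 (Fin.last n)))⁻¹ - w.2.1 (Fin.last n)) •
      EuclideanSpace.single (Fin.last n) 1, w.2.2)

lemma add_smul_single_last_eq {n : ℕ} {x x' : EuclideanSpace ℝ (Fin (n + 1))} {c c' : ℝ}
    (h : x + c • EuclideanSpace.single (Fin.last n) 1 =
      x' + c' • EuclideanSpace.single (Fin.last n) 1)
    (hl : x (Fin.last n) + c = x' (Fin.last n) + c' → x (Fin.last n) = x' (Fin.last n)) :
    x = x' := by
  ext i
  have hi := congrArg (fun u : EuclideanSpace ℝ (Fin (n + 1)) => u i) h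
  by_cases hin : i = Fin.last n
  · subst hin
    exact hl (by simpa using hi)
  · simpa [hin] using hi

lemma injective_lastLift {n : ℕ} {h : ℝ → ℝ} (hpos : ∀ x, 0 < deriv h x) :
    Function.Injective (lastLift h : JetSpace (n + 1) → _) := by
  rintro ⟨x, y, z⟩ ⟨x', y', z'⟩ he
  simp only [lastLift, Prod.mk.injEq] at he
  obtain ⟨h1, h2, h3⟩ := he
  have hx : x = x' := add_smul_single_last_eq h1 fun e =>
    (strictMono_of_deriv_pos hpos).injective (by simpa using e)
  subst hx
  have hy : y = y' := add_smul_single_last_eq h2 fun e => by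
    have := (hpos (x (Fin.last n))).ne'
    simpa [this] using e
  rw [hy, h3]

lemma contDiff_inv_deriv {h : ℝ → ℝ} (hh : ContDiff ℝ ∞ h) (hpos : ∀ x, 0 < deriv h x) :
    ContDiff ℝ ∞ fun x => (deriv h x)⁻¹ :=
  (contDiff_infty_iff_deriv.1 hh).2.inv fun x => (hpos x).ne'

lemma contDiff_lastLift {n : ℕ} {h : ℝ → ℝ} (hh : ContDiff ℝ ∞ h) (hpos : ∀ x, 0 < deriv h x) :
    ContDiff ℝ ∞ (lastLift h : JetSpace (n + 1) → _) := by
  have hx : ContDiff ℝ ∞ fun w : JetSpace (n + 1) => w.1 (Fin.last n) := by fun_prop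
  have hy : ContDiff ℝ ∞ fun w : JetSpace (n + 1) => w.2.1 (Fin.last n) := by fun_prop
  have h1 := hh.comp hx
  have h2 := (contDiff_inv_deriv hh hpos).comp hx
  exact (contDiff_fst.add ((h1.sub hx).smul contDiff_const)).prodMk
    ((contDiff_snd.fst.add (((hy.mul h2).sub hy).smul contDiff_const)).prodMk contDiff_snd.snd)

lemma fderiv_lastLift {n : ℕ} {h : ℝ → ℝ} (hh : ContDiff ℝ ∞ h) (hpos : ∀ x, 0 < deriv h x)
    (w v : JetSpace (n + 1)) : fderiv ℝ (lastLift h) w v =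
      (v.1 + (deriv h (w.1 (Fin.last n)) * v.1 (Fin.last n) - v.1 (Fin.last n)) •
          EuclideanSpace.single (Fin.last n) 1,
        v.2.1 + ((w.2.1 (Fin.last n) * (deriv (fun x => (deriv h x)⁻¹) (w.1 (Fin.last n)) *
            v.1 (Fin.last n)) + (deriv h (w.1 (Fin.last n)))⁻¹ * v.2.1 (Fin.last n)) -
            v.2.1 (Fin.last n)) • EuclideanSpace.single (Fin.last n) 1, v.2.2) := by
  let X : JetSpace (n + 1) →L[ℝ] ℝ :=
    (EuclideanSpace.proj (Fin.last n)).comp (ContinuousLinearMap.fst ℝ _ _)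
  let Y : JetSpace (n + 1) →L[ℝ] ℝ := (EuclideanSpace.proj (Fin.last n)).comp
    ((ContinuousLinearMap.fst ℝ _ _).comp (ContinuousLinearMap.snd ℝ _ _))
  have hX : HasFDerivAt X X w := X.hasFDerivAt
  have hY : HasFDerivAt Y Y w := Y.hasFDerivAt
  have h1 := (hh.differentiable (by simp) (X w)).hasDerivAt.comp_hasFDerivAt w hX
  have h2 := ((contDiff_inv_deriv hh hpos).differentiable (by simp)
    (X w)).hasDerivAt.comp_hasFDerivAt w hX
  have h3 := (hasFDerivAt_fst.add ((h1.sub hX).smul_const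
    (EuclideanSpace.single (Fin.last n) (1 : ℝ)))).prodMk
    (((hasFDerivAt_snd (p := w)).fst.add (((hY.mul h2).sub hY).smul_const
      (EuclideanSpace.single (Fin.last n) (1 : ℝ)))).prodMk (hasFDerivAt_snd (p := w)).snd)
  exact DFunLike.congr_fun h3.fderiv v

lemma injective_fderiv_lastLift {n : ℕ} {h : ℝ → ℝ} (hh : ContDiff ℝ ∞ h)
    (hpos : ∀ x, 0 < deriv h x) (w : JetSpace (n + 1)) :
    Function.Injective (fderiv ℝ (lastLift h) w) := by
  rintro ⟨x, y, z⟩ ⟨x', y', z'⟩ he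
  rw [fderiv_lastLift hh hpos, fderiv_lastLift hh hpos] at he
  simp only [Prod.mk.injEq] at he
  obtain ⟨h1, h2, h3⟩ := he
  have h0 := (hpos (w.1 (Fin.last n))).ne'
  have hx : x = x' := add_smul_single_last_eq h1 fun e => by simpa [h0] using e
  subst hx
  have hy : y = y' := add_smul_single_last_eq h2 fun e => by simpa [h0] using e
  rw [hy, h3]

/-- The slope is divided by h' while dx_n is multiplied by h', so y_n dx_n is unchanged. -/
lemma contactForm_fderiv_lastLift {n : ℕ} {h : ℝ → ℝ} (hh : ContDiff ℝ ∞ h)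
    (hpos : ∀ x, 0 < deriv h x) (w v : JetSpace (n + 1)) :
    contactForm (lastLift h w) (fderiv ℝ (lastLift h) w v) = contactForm w v := by
  have h0 := (hpos (w.1 (Fin.last n))).ne'
  rw [fderiv_lastLift hh hpos]
  simp only [contactForm, lastLift, Fin.sum_univ_castSucc, PiLp.add_apply, PiLp.smul_apply,
    PiLp.single_apply, smul_eq_mul, (Fin.castSucc_lt_last _).ne, if_true, if_false, mul_zero,
    add_zero, mul_one]
  field_simp
  ring

/-! ### Loose charts -/

lemma convex_looseBox (k : ℕ) (a b c : ℝ) : Convex ℝ (looseBox k a b c) := by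
  let p {d : ℕ} (i : Fin d) : EuclideanSpace ℝ (Fin d) →L[ℝ] ℝ := EuclideanSpace.proj i
  let X : JetSpace (k + 1) →L[ℝ] EuclideanSpace ℝ (Fin (k + 1)) := ContinuousLinearMap.fst ℝ _ _
  let Y : JetSpace (k + 1) →L[ℝ] EuclideanSpace ℝ (Fin (k + 1)) :=
    (ContinuousLinearMap.fst ℝ _ _).comp (ContinuousLinearMap.snd ℝ _ _)
  let Z : JetSpace (k + 1) →L[ℝ] ℝ :=
    (ContinuousLinearMap.snd ℝ _ _).comp (ContinuousLinearMap.snd ℝ _ _)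
  let S : EuclideanSpace ℝ (Fin (k + 1)) →L[ℝ] EuclideanSpace ℝ (Fin k) := coordPullback Fin.succ
  have key {F : Type} [NormedAddCommGroup F] [NormedSpace ℝ F] (T : JetSpace (k + 1) →L[ℝ] F)
      (r : ℝ) : Convex ℝ (T ⁻¹' Metric.closedBall 0 r) :=
    (convex_closedBall 0 r).linear_preimage (T : JetSpace (k + 1) →ₗ[ℝ] F)
  convert (key ((p 0).comp X) 1).inter ((key ((p 0).comp Y) 1).inter
    ((key (S.comp X) b).inter ((key (S.comp Y) c).inter (key Z a)))) using 1
  ext w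
  simp [looseBox, p, X, Y, Z, S, EuclideanSpace.norm_eq]

/-- A convex set with interior point 0 has unique derivatives, which makes the chain rule available
for `fderivWithin` up to the boundary. -/
lemma uniqueDiffOn_looseBox (k : ℕ) {a b c : ℝ} (ha : 0 < a) (hb : 0 < b) (hc : 0 < c) :
    UniqueDiffOn ℝ (looseBox k a b c) := by
  refine uniqueDiffOn_convex (convex_looseBox k a b c) ⟨0, mem_interior_iff_mem_nhds.2 ?_⟩
  have h {F : JetSpace (k + 1) → ℝ} (hF : Continuous F) {r : ℝ} (hr : F 0 < r) :
      ∀ᶠ w in 𝓝 0, F w < r := hF.continuousAt.eventually (gt_mem_nhds hr)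
  filter_upwards [h (F := fun w => |w.1 0|) (r := 1) (by fun_prop) (by simp),
    h (F := fun w => |w.2.1 0|) (r := 1) (by fun_prop) (by simp),
    h (F := fun w => √(∑ i : Fin k, w.1 i.succ ^ 2)) (r := b) (by fun_prop) (by simpa),
    h (F := fun w => √(∑ i : Fin k, w.2.1 i.succ ^ 2)) (r := c) (by fun_prop) (by simpa),
    h (F := fun w => |w.2.2|) (r := a) (by fun_prop) (by simpa)] with w h1 h2 h3 h4 h5
  exact ⟨h1.le, h2.le, h3.le, h4.le, h5.le⟩

/-- A loose chart may be composed with an injective strict contact immersion. -/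
lemma IsLooseChart.comp {k : ℕ} {a b c : ℝ} (ha : 0 < a) (hb : 0 < b) (hc : 0 < c)
    {lam : Set (ℝ × ℝ × ℝ)} {L : Set (JetSpace (k + 1))}
    {ψ κ : JetSpace (k + 1) → JetSpace (k + 1)} (hψ : IsLooseChart a b c lam L ψ)
    (hκ : ContDiff ℝ ∞ κ) (hinj : Function.Injective κ)
    (hκ' : ∀ w, Function.Injective (fderiv ℝ κ w))
    (hcon : ∀ w v, contactForm (κ w) (fderiv ℝ κ w v) = contactForm w v) :
    IsLooseChart a b c lam (κ '' L) (κ ∘ ψ) := by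
  have hfd (w) (hw : w ∈ looseBox k a b c) : fderivWithin ℝ (κ ∘ ψ) (looseBox k a b c) w =
      (fderiv ℝ κ (ψ w)).comp (fderivWithin ℝ ψ (looseBox k a b c) w) :=
    fderiv_comp_fderivWithin w (hκ.differentiable (by simp) _)
      (hψ.contDiffOn.differentiableOn (by simp) w hw) (uniqueDiffOn_looseBox k ha hb hc w hw)
  refine ⟨hκ.comp_contDiffOn hψ.contDiffOn, hinj.comp_injOn hψ.injOn, fun w hw => ?_, ?_,
    fun w hw => ?_⟩
  · have hi : Function.Injective (fderivWithin ℝ (κ ∘ ψ) (looseBox k a b c) w) := by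
      rw [hfd w hw]
      exact (hκ' _).comp (hψ.bijective_fderivWithin w hw).injective
    exact ⟨hi, LinearMap.injective_iff_surjective.1 hi⟩
  · obtain ⟨g, hg⟩ := hψ.conformal
    refine ⟨g, fun w hw => ⟨(hg w hw).1, fun v => ?_⟩⟩
    rw [hfd w hw, ← (hg w hw).2 v]
    exact hcon _ _
  · rw [Function.comp_apply, hinj.mem_set_image, hψ.mem_iff w hw]

/-! ### Loose charts of spun Legendrians -/

/-- The inclusion of the first `n + 1` indices. -/
def firstIdx (n m : ℕ) : Fin (n + 1) → Fin (n + m + 1) :=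
  Fin.cons 0 fun i => (Fin.castAdd m i).succ

/-- The inclusion of the last `m` indices. -/
def restIdx (n m : ℕ) (j : Fin m) : Fin (n + m + 1) := (Fin.natAdd n j).succ

/-- The box singles out index 0, so in the source of the chart the coordinates are split after the
first n + 1, unlike the splitting at the spun block in the target. -/
lemma sum_firstIdx_restIdx (n m : ℕ) (F : Fin (n + m + 1) → ℝ) :
    ∑ i, F i = ∑ i, F (firstIdx n m i) + ∑ j, F (restIdx n m j) := by
  simp [Fin.sum_univ_succ, Fin.sum_univ_add, firstIdx, restIdx, add_assoc]

lemma eq_of_firstIdx_restIdx {n m : ℕ} {x x' : EuclideanSpace ℝ (Fin (n + m + 1))}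
    (h1 : coordPullback (firstIdx n m) x = coordPullback (firstIdx n m) x')
    (h2 : coordPullback (restIdx n m) x = coordPullback (restIdx n m) x') : x = x' := by
  ext i
  refine Fin.cases ?_ (fun i => Fin.addCases (fun i => ?_) (fun j => ?_) i) i
  · exact congrArg (fun u : EuclideanSpace ℝ (Fin (n + 1)) => u 0) h1
  · exact congrArg (fun u : EuclideanSpace ℝ (Fin (n + 1)) => u i.succ) h1
  · exact congrArg (fun u : EuclideanSpace ℝ (Fin m) => u j) h2

/-- The jet in the first `n + 1` coordinates. -/
noncomputable def firstJet (n m : ℕ) : JetSpace (n + m + 1) →L[ℝ] JetSpace (n + 1) :=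
  ((coordPullback (firstIdx n m)).comp (ContinuousLinearMap.fst ℝ _ _)).prod
    (((coordPullback (firstIdx n m)).comp
      ((ContinuousLinearMap.fst ℝ _ _).comp (ContinuousLinearMap.snd ℝ _ _))).prod
      ((ContinuousLinearMap.snd ℝ _ _).comp (ContinuousLinearMap.snd ℝ _ _)))

/-- The last `m` coordinates of the base point. -/
noncomputable def restX (n m : ℕ) : JetSpace (n + m + 1) →L[ℝ] EuclideanSpace ℝ (Fin m) :=
  (coordPullback (restIdx n m)).comp (ContinuousLinearMap.fst ℝ _ _)

/-- The last `m` slopes. -/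
noncomputable def restY (n m : ℕ) : JetSpace (n + m + 1) →L[ℝ] EuclideanSpace ℝ (Fin m) :=
  (coordPullback (restIdx n m)).comp
    ((ContinuousLinearMap.fst ℝ _ _).comp (ContinuousLinearMap.snd ℝ _ _))

lemma jet_ext {n m : ℕ} {w w' : JetSpace (n + m + 1)} (h1 : firstJet n m w = firstJet n m w')
    (h2 : restX n m w = restX n m w') (h3 : restY n m w = restY n m w') : w = w' :=
  Prod.ext (eq_of_firstIdx_restIdx (congrArg Prod.fst h1) h2)
    (Prod.ext (eq_of_firstIdx_restIdx (congrArg (fun u => u.2.1) h1) h3)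
      (congrArg (fun u => u.2.2) h1))

/-- This is the splitting J¹(ℝⁿ⁺ᵐ⁺¹) = J¹(ℝⁿ⁺¹) × T*ℝᵐ, with form α - p dq. -/
lemma contactForm_eq_firstJet_sub {n m : ℕ} (w v : JetSpace (n + m + 1)) :
    contactForm w v = contactForm (firstJet n m w) (firstJet n m v) -
      inner ℝ (restY n m w) (restX n m v) := by
  rw [inner_eq_sum]
  simp only [contactForm]
  rw [sum_firstIdx_restIdx, ← sub_sub]
  rfl

lemma sum_succ_sq {n m : ℕ} (x : EuclideanSpace ℝ (Fin (n + m + 1))) :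
    ∑ i : Fin (n + m), x i.succ ^ 2 =
      ∑ i : Fin n, coordPullback (firstIdx n m) x i.succ ^ 2 +
        ∑ j, coordPullback (restIdx n m) x j ^ 2 :=
  Fin.sum_univ_add fun i : Fin (n + m) => x i.succ ^ 2

lemma sqrt_sum_firstIdx_le {n m : ℕ} (x : EuclideanSpace ℝ (Fin (n + m + 1))) :
    √(∑ i : Fin n, coordPullback (firstIdx n m) x i.succ ^ 2) ≤
      √(∑ i : Fin (n + m), x i.succ ^ 2) := by
  refine Real.sqrt_le_sqrt ?_
  rw [sum_succ_sq]
  exact le_add_of_nonneg_right (Finset.sum_nonneg fun j _ => sq_nonneg _)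

/-- Forgetting coordinates does not increase norms, so the same a, b, c serve for both boxes. -/
lemma mapsTo_firstJet_looseBox (n m : ℕ) (a b c : ℝ) :
    MapsTo (firstJet n m) (looseBox (n + m) a b c) (looseBox n a b c) := fun w hw =>
  ⟨hw.1, hw.2.1, (sqrt_sum_firstIdx_le w.1).trans hw.2.2.1,
    (sqrt_sum_firstIdx_le w.2.1).trans hw.2.2.2.1, hw.2.2.2.2⟩

lemma mem_looseCylinder_iff {n m : ℕ} {a b c : ℝ} {lam : Set (ℝ × ℝ × ℝ)}
    {w : JetSpace (n + m + 1)} (hw : w ∈ looseBox (n + m) a b c) :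
    w ∈ looseCylinder (n + m) b lam ↔
      firstJet n m w ∈ looseCylinder n b lam ∧ restY n m w = 0 := by
  constructor
  · rintro ⟨h1, h2, h3⟩
    refine ⟨⟨h1, (sqrt_sum_firstIdx_le w.1).trans h2, fun i => h3 (Fin.castAdd m i)⟩, ?_⟩
    ext j
    exact h3 (Fin.natAdd n j)
  · rintro ⟨⟨h1, h2, h3⟩, h4⟩
    refine ⟨h1, hw.2.2.1, fun i => Fin.addCases (fun i => h3 i) (fun j => ?_) i⟩
    exact congrArg (fun u : EuclideanSpace ℝ (Fin m) => u j) h4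

lemma contactForm_reeb {d : ℕ} (w : JetSpace d) : contactForm w (0, 0, 1) = 1 := by
  simp [contactForm]

/-- A loose chart with image in `{x_n > 0}` yields a loose chart of the spun Legendrian. -/
theorem IsLooseChart.exists_frontSpin {n : ℕ} (m : ℕ) {a b c : ℝ} (ha : 0 < a) (hb : 0 < b) (hc : 0 < c)
    {lam : Set (ℝ × ℝ × ℝ)} {M : Type*} {f : M → JetSpace (n + 1)}
    (hf : ∀ p, 0 < (f p).1 (Fin.last n)) {ψ : JetSpace (n + 1) → JetSpace (n + 1)}
    (hψ : IsLooseChart a b c lam (range f) ψ)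
    (hpos : ∀ w ∈ looseBox n a b c, 0 < (ψ w).1 (Fin.last n)) :
    ∃ ψ', IsLooseChart (k := n + m) a b c lam (range (frontSpin m f)) ψ' := by
  obtain ⟨g, hg⟩ := hψ.conformal
  set B := looseBox n a b c
  set B' : Set (JetSpace (n + m + 1)) := looseBox (n + m) a b c
  have hB : UniqueDiffOn ℝ B := uniqueDiffOn_looseBox n ha hb hc
  have hB' : UniqueDiffOn ℝ B' := uniqueDiffOn_looseBox (n + m) ha hb hc
  have hmaps : MapsTo (firstJet n m) B' B := mapsTo_firstJet_looseBox n m a b c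
  -- The conformal factor is the pulled-back form evaluated on ∂/∂z, hence smooth.
  have hgs : ContDiffOn ℝ ∞ g B := by
    have h1 : ContDiffOn ℝ ∞ (fun w => fderivWithin ℝ ψ B w (0, 0, 1)) B :=
      (hψ.contDiffOn.fderivWithin hB (by simp)).clm_apply contDiffOn_const
    have h2 : ContDiffOn ℝ ∞ (fun w => (fderivWithin ℝ ψ B w (0, 0, 1)).2.2 -
        inner ℝ (ψ w).2.1 (fderivWithin ℝ ψ B w (0, 0, 1)).1) B :=
      h1.snd.snd.sub (hψ.contDiffOn.snd.fst.inner ℝ h1.fst)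
    refine h2.congr fun w hw => ?_
    rw [← contactForm_eq_inner, (hg w hw).2, contactForm_reeb, mul_one]
  -- Multiplying the fibre coordinate p by g makes the Liouville form scale by the same factor as α.
  let T : JetSpace (n + m + 1) →
      JetSpace (n + 1) × EuclideanSpace ℝ (Fin m) × EuclideanSpace ℝ (Fin m) :=
    fun w => (ψ (firstJet n m w), restX n m w, g (firstJet n m w) • restY n m w)
  have hψP : ContDiffOn ℝ ∞ (fun w => ψ (firstJet n m w)) B' :=
    hψ.contDiffOn.comp (firstJet n m).contDiff.contDiffOn hmaps
  have hgP : ContDiffOn ℝ ∞ (fun w => g (firstJet n m w)) B' :=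
    hgs.comp (firstJet n m).contDiff.contDiffOn hmaps
  have hT : ContDiffOn ℝ ∞ T B' := hψP.prodMk ((restX n m).contDiff.contDiffOn.prodMk
    (hgP.smul (restY n m).contDiff.contDiffOn))
  have hTd (w) (hw : w ∈ B') (v) : fderivWithin ℝ T B' w v =
      (fderivWithin ℝ ψ B (firstJet n m w) (firstJet n m v), restX n m v,
        g (firstJet n m w) • restY n m v +
          fderivWithin ℝ g B (firstJet n m w) (firstJet n m v) • restY n m w) := by
    have hP := (firstJet n m).hasFDerivWithinAt (x := w) (s := B')
    have h1 := (hψ.contDiffOn.differentiableOn (by simp) _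
      (hmaps hw)).hasFDerivWithinAt.comp w hP hmaps
    have h2 := (hgs.differentiableOn (by simp) _ (hmaps hw)).hasFDerivWithinAt.comp w hP hmaps
    have h3 := h1.prodMk ((restX n m).hasFDerivWithinAt.prodMk
      (h2.smul (restY n m).hasFDerivWithinAt))
    exact DFunLike.congr_fun (h3.fderivWithin (hB' w hw)) v
  have hS (w) (hw : w ∈ B') : ContDiffAt ℝ ∞ (spinChart n m) (T w) :=
    contDiffAt_spinChart (hpos _ (hmaps hw))
  have hd (w) (hw : w ∈ B') : fderivWithin ℝ (spinChart n m ∘ T) B' w =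
      (fderiv ℝ (spinChart n m) (T w)).comp (fderivWithin ℝ T B' w) :=
    fderiv_comp_fderivWithin w ((hS w hw).differentiableAt (by simp))
      (hT.differentiableOn (by simp) w hw) (hB' w hw)
  refine ⟨spinChart n m ∘ T, fun w hw => (hS w hw).comp_contDiffWithinAt w (hT w hw),
    fun w hw w' hw' h => ?_, fun w hw => ?_, ⟨fun w => g (firstJet n m w), fun w hw => ?_⟩,
    fun w hw => ?_⟩
  · have hTT : T w = T w' := by
      rw [← cartesianJet_unspinJet_spinChart (b := T w) (hpos _ (hmaps hw)),
        ← cartesianJet_unspinJet_spinChart (b := T w') (hpos _ (hmaps hw'))]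
      exact congrArg _ (congrArg _ h)
    simp only [T, Prod.mk.injEq] at hTT
    have h1 := hψ.injOn (hmaps hw) (hmaps hw') hTT.1
    refine jet_ext h1 hTT.2.1 (smul_right_injective _ (hg _ (hmaps hw)).1 ?_)
    simpa only [h1] using hTT.2.2
  · have hi : Function.Injective (fderivWithin ℝ (spinChart n m ∘ T) B' w) := by
      rw [hd w hw]
      refine (injective_fderiv_spinChart (hpos _ (hmaps hw))).comp fun v v' h => ?_
      replace h := (hTd w hw v).symm.trans (h.trans (hTd w hw v'))
      simp only [Prod.mk.injEq] at h
      -- The derivative of `T` is triangular: once the first components agree, the terms with the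
      -- derivative of `g` coincide, and g ≠ 0 gives the rest.
      have h1 := (hψ.bijective_fderivWithin _ (hmaps hw)).injective h.1
      refine jet_ext h1 h.2.1 (smul_right_injective _ (hg _ (hmaps hw)).1 ?_)
      simpa only [h1, add_left_inj] using h.2.2
    exact ⟨hi, LinearMap.injective_iff_surjective.1 hi⟩
  · refine ⟨(hg _ (hmaps hw)).1, fun v => ?_⟩
    rw [hd w hw]
    refine (contactForm_fderiv_spinChart (hpos _ (hmaps hw)) (fderivWithin ℝ T B' w v)).trans ?_
    rw [hTd w hw, contactForm_eq_firstJet_sub, mul_sub, ← (hg _ (hmaps hw)).2]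
    simp only [T]
    rw [real_inner_smul_left]
  · rw [mem_looseCylinder_iff hw, ← hψ.mem_iff _ (hmaps hw)]
    have hr : 0 < (T w).1.1 (Fin.last n) := hpos _ (hmaps hw)
    -- The tangential slope ζ vanishes exactly on the zero section p = 0, as g, N and r are nonzero.
    have hs : ((centralNorm (T w).2.1 * ((T w).1.1 (Fin.last n))⁻¹) •
        centralCovec (T w).2.1 (T w).2.2 = 0) ↔ restY n m w = 0 := by
      rw [smul_eq_zero_iff_right (mul_ne_zero (centralNorm_pos _).ne' (inv_ne_zero hr.ne'))]
      refine ⟨fun h => ?_, fun h => ?_⟩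
      · have h' := congrArg (dropZero m) h
        rw [centralCovec, dropZero_consVec, map_zero] at h'
        exact (smul_eq_zero_iff_right (hg _ (hmaps hw)).1).1 h'
      · have h0 : (T w).2.2 = 0 := by simp only [T, h, smul_zero]
        rw [centralCovec, h0, inner_zero_left, neg_zero, ← Prod.zero_eq_mk, map_zero]
    constructor
    · rintro ⟨q, hq⟩
      rw [frontSpin_eq_spinJet] at hq
      have h1 := congrArg (unspinJet n m) hq
      rw [unspinJet_spinJet (hf q.1) (inner_self_coe_sphere q.2) (inner_zero_left _),
        Function.comp_apply, unspinJet_spinChart hr] at h1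
      exact ⟨⟨q.1, congrArg Prod.fst h1⟩, hs.1 (congrArg (fun u => u.2.2) h1).symm⟩
    · rintro ⟨⟨p, hp⟩, hy⟩
      refine ⟨(p, ⟨centralProj (T w).2.1, ?_⟩), ?_⟩
      · have := inner_centralProj_self (T w).2.1
        rw [real_inner_self_eq_norm_sq] at this
        rw [mem_sphere_zero_iff_norm]
        nlinarith [norm_nonneg (centralProj (T w).2.1)]
      · rw [frontSpin_eq_spinJet, Function.comp_apply, spinChart, Function.comp_apply,
          sphericalJet, hs.2 hy, hp]

theorem proposition1p7 (n m : ℕ) {M : Type*} [TopologicalSpace M]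
    [ChartedSpace (EuclideanSpace ℝ (Fin (n + 1))) M] [IsManifold (𝓡 (n + 1)) ∞ M]
    [CompactSpace M] (f : M → JetSpace (n + 1)) (hf : IsLegendrianEmbedding (𝓡 (n + 1)) f)
    (hloose : IsLoose (Set.range f)) :
    (∃ s : ℝ, ∀ p, 0 < (translateLast s (f p)).1 (Fin.last n)) ∧
    ∀ s : ℝ, (∀ p, 0 < (translateLast s (f p)).1 (Fin.last n)) →
      IsLegendrianEmbedding ((𝓡 (n + 1)).prod (𝓡 m)) (frontSpin m (translateLast s ∘ f)) ∧
      IsLoose (Set.range (frontSpin m (translateLast s ∘ f))) := by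
  have hlast (s : ℝ) (w : JetSpace (n + 1)) :
      (translateLast s w).1 (Fin.last n) = w.1 (Fin.last n) + s := by simp [translateLast]
  have hcont : Continuous fun p => (f p).1 (Fin.last n) := by
    have := hf.contMDiff.continuous
    fun_prop
  refine ⟨?_, fun s hs => ⟨?_, ?_⟩⟩
  · obtain ⟨C, hC⟩ := (isCompact_range hcont).bddBelow
    refine ⟨1 - C, fun p => ?_⟩
    rw [hlast]
    linarith [hC ⟨p, rfl⟩]
  · refine isLegendrianEmbedding_frontSpin m ?_ hs
    have ht (w : JetSpace (n + 1)) : translateLast s w =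
        w + (EuclideanSpace.single (Fin.last n) s, 0, 0) := by simp [translateLast, Prod.ext_iff]
    have htd (w : JetSpace (n + 1)) :
        HasFDerivAt (translateLast s) (ContinuousLinearMap.id ℝ (JetSpace (n + 1))) w := by
      rw [funext ht]
      exact (hasFDerivAt_id w).add_const _
    have htc : ContDiff ℝ ∞ (translateLast s : JetSpace (n + 1) → _) := by
      rw [funext ht]
      exact contDiff_id.add contDiff_const
    have hmf (p) : mfderiv (𝓡 (n + 1)) 𝓘(ℝ, JetSpace (n + 1)) (translateLast s ∘ f) p =
        mfderiv (𝓡 (n + 1)) 𝓘(ℝ, JetSpace (n + 1)) f p :=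
      ((htd (f p)).hasMFDerivAt.comp p
        ((hf.contMDiff p).mdifferentiableAt (by simp)).hasMFDerivAt).mfderiv
    have hti : Function.Injective (translateLast s : JetSpace (n + 1) → _) := fun w w' h => by
      rwa [ht, ht, add_left_inj] at h
    refine ⟨hf.finrank_eq, htc.contMDiff.comp hf.contMDiff, fun p => ?_, ?_, fun p v => ?_⟩
    · rw [hmf]
      exact hf.injective_mfderiv p
    · exact ((htc.continuous.comp hf.contMDiff.continuous).isClosedEmbedding
        (hti.comp hf.isEmbedding.injective)).isEmbedding
    · rw [hmf]
      exact hf.tangent p v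
  · obtain ⟨a, b, c, ha, hb, hc, habc, lam, hlam, ψ, hψ⟩ := hloose
    refine ⟨a, b, c, ha, hb, hc, habc, lam, hlam, ?_⟩
    -- Half the minimum of the translated last coordinate; any ε works if `M` is empty.
    obtain ⟨ε, hε, hεf⟩ : ∃ ε : ℝ, 0 < ε ∧ ∀ p, ε < (f p).1 (Fin.last n) + s := by
      rcases isEmpty_or_nonempty M with hM | hM
      · exact ⟨1, one_pos, fun p => isEmptyElim p⟩
      · obtain ⟨p₀, -, hp₀⟩ := isCompact_univ.exists_isMinOn univ_nonempty hcont.continuousOn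
        have h0 := hs p₀
        rw [hlast] at h0
        refine ⟨((f p₀).1 (Fin.last n) + s) / 2, by positivity, fun p => ?_⟩
        have : (f p₀).1 (Fin.last n) ≤ (f p).1 (Fin.last n) := hp₀ (mem_univ p)
        linarith
    obtain ⟨h, hh, hpos, hp, hfix⟩ := exists_contDiff_pos_eq_self hε
    let h' : ℝ → ℝ := fun x => h (x + s)
    have hd' (x) : deriv h' x = deriv h (x + s) := deriv_comp_add_const h s x
    have hh' : ContDiff ℝ ∞ h' := hh.comp (contDiff_id.add contDiff_const)
    have hpos' (x) : 0 < deriv h' x := by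
      rw [hd']
      exact hpos _
    -- The strict bound ε < r makes h the identity near r, so its derivative is 1 and the slopes on
    -- Λ are unchanged.
    have heq (p) : lastLift h' (f p) = translateLast s (f p) := by
      have h1 : h' ((f p).1 (Fin.last n)) = (f p).1 (Fin.last n) + s := hfix _ (hεf p).le
      have h2 : deriv h' ((f p).1 (Fin.last n)) = 1 := by
        rw [hd']
        have : h =ᶠ[𝓝 ((f p).1 (Fin.last n) + s)] id := by
          filter_upwards [Ioi_mem_nhds (hεf p)] with x hx using hfix x (le_of_lt hx)
        rw [this.deriv_eq, deriv_id]
      have h3 : s • EuclideanSpace.single (Fin.last n) (1 : ℝ) =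
          EuclideanSpace.single (Fin.last n) s := by
        ext i
        simp [PiLp.single_apply]
      simp [lastLift, translateLast, h1, h2, h3]
    have hκ := hψ.comp ha hb hc (contDiff_lastLift hh' hpos') (injective_lastLift hpos')
      (injective_fderiv_lastLift hh' hpos') (contactForm_fderiv_lastLift hh' hpos')
    rw [← range_comp, show lastLift h' ∘ f = translateLast s ∘ f from funext heq] at hκ
    refine hκ.exists_frontSpin m ha hb hc hs fun w _ => ?_
    simpa [lastLift] using hp _
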